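/- Let $\mathcal G=(\mathcal V,\mathcal E)$ be a finite connected simple undirected graph, let $\mathcal R\subset\mathcal V$ be a nonempty set of reference nodes whose complement $\mathcal F=\mathcal V\setminus\mathcal R$ (the followers) is also nonempty, and let $\mathcal L_g$ be the grounded Laplacian, i.e. the matrix obtained from the graph Laplacian $D-A$ by removing the rows and columns indexed by $\mathcal R$. Let $\lambda_1(\mathcal L_g)\le\dots\le\lambda_{|\mathcal F|}(\mathcal L_g)$ be its eigenvalues and let $\tau_{\max}\ge 0$. Consider, for a constant delay $\tau\ge 0$, the delayed velocity-tracking dynamics $$\dot u(t)=-\mathcal L_g\,u(t-\tau),\qquad t>0,\qquad u(t)\in\mathbb R^{|\mathcal F|},$$ with continuous initial history on $[-\tau,0]$. It is called asymptotically stable if for every $\varepsilon>0$ there is $\delta>0$ such that every solution whose history satisfies $\sup_{s\in[-\tau,0]}\|u(s)\|<\delta$ has $\|u(t)\|<\varepsilon$ for all $t\ge0$, and every solution satisfies $u(t)\to0$ as $t\to\infty$. Then the dynamics is asymptotically stable for every constant delay $\tau\in[0,\tau_{\max}]$ if and only if $$\tau_{\max}<\min_{1\le i\le|\mathcal F|}\frac{\pi}{2\lambda_i(\mathcal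 L_g)}=\frac{\pi}{2\lambda_{|\mathcal F|}(\mathcal L_g)}.$$ -/

import Mathlib

/-- The follower vehicles: the nodes that are not reference (grounded) nodes. -/
abbrev Follower {V : Type*} (R : Finset V) : Type _ := {v : V // v ∉ R}

/-- The grounded Laplacian: the graph Laplacian `D - A` with the rows and columns of the
nodes in `R` removed. -/
def groundedLaplacian {V : Type*} [Fintype V] [DecidableEq V] (G : SimpleGraph V)
    [DecidableRel G.Adj] (R : Finset V) : Matrix (Follower R) (Follower R) ℝ :=
  (G.lapMatrix ℝ).submatrix Subtype.val Subtype.val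

theorem groundedLaplacian_isHermitian {V : Type*} [Fintype V] [DecidableEq V]
    (G : SimpleGraph V) [DecidableRel G.Adj] (R : Finset V) :
    (groundedLaplacian G R).IsHermitian := by
  have h : (G.lapMatrix ℝ).IsHermitian := by
    rw [Matrix.IsHermitian, Matrix.conjTranspose_eq_transpose_of_trivial]
    exact SimpleGraph.isSymm_lapMatrix (R := ℝ) G
  exact h.submatrix _

/-- The eigenvalues (with multiplicity, all real) of the grounded Laplacian. -/
noncomputable def groundedEigenvalues {V : Type*} [Fintype V] [DecidableEq V]
    (G : SimpleGraph V) [DecidableRel G.Adj] (R : Finset V) : Follower R → ℝ :=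
  (groundedLaplacian_isHermitian G R).eigenvalues

/-- The largest eigenvalue of the grounded Laplacian. -/
noncomputable def largestGroundedEigenvalue {V : Type*} [Fintype V] [DecidableEq V]
    (G : SimpleGraph V) [DecidableRel G.Adj] (R : Finset V) [Nonempty (Follower R)] : ℝ :=
  Finset.univ.sup' Finset.univ_nonempty (groundedEigenvalues G R)

/-- `x` solves `x'(t) = A x(t - τ)` for `t > 0`, with continuous initial history on `[-τ, 0]`.
Only the values of `x` on `[-τ, ∞)` matter. -/
structure IsDelaySolution {ι : Type*} [Fintype ι] (A : Matrix ι ι ℝ) (τ : ℝ)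
    (x : ℝ → ι → ℝ) : Prop where
  continuousOn : ContinuousOn x (Set.Ici (-τ))
  hasDerivAt : ∀ t : ℝ, 0 < t → HasDerivAt x (A.mulVec (x (t - τ))) t

/-- Asymptotic stability of (the zero solution of) the linear delay system
`x'(t) = A x(t - τ)`: it is Lyapunov stable with respect to the uniform norm of the initial
history on `[-τ, 0]`, and every solution tends to zero. (All norms on the
finite-dimensional state space give the same notion; the one used is the max norm.) -/
structure IsAsymptoticallyStableDelay {ι : Type*} [Fintype ι] (A : Matrix ι ι ℝ) (τ : ℝ) :
    Prop where
  stable : ∀ ε : ℝ, 0 < ε → ∃ δ : ℝ, 0 < δ ∧ ∀ x : ℝ → ι → ℝ, IsDelaySolution A τ x →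
    (∀ s ∈ Set.Icc (-τ) 0, ‖x s‖ < δ) → ∀ t : ℝ, 0 ≤ t → ‖x t‖ < ε
  attractive : ∀ x : ℝ → ι → ℝ, IsDelaySolution A τ x →
    Filter.Tendsto x Filter.atTop (nhds 0)

/-! An orthonormal eigenbasis of the grounded Laplacian decouples the system into scalar equations
`f'(t) = -l f(t - τ)`. All `l` are positive: a vector of zero Dirichlet energy, extended by zero, is
constant on the connected graph and vanishes on `R`.

For `τ > 0`, after rescaling time, the solution segments are iterates of one bounded operator,
`delayStep (l * τ)`, on `C([0, 1])`. A nonzero spectral value `μ` must satisfy `μ = exp (-a / μ)`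
with `a = l * τ`, which is impossible for `1 ≤ ‖μ‖` if `0 < a < π / 2` (`delay_characteristic_ne`).
Gelfand's formula then makes the powers tend to zero in norm, giving both stability and attraction.

Conversely, at `τ = π / (2 l)` a cosine solution does not decay. If `τmax` reaches the bound for
some eigenvalue, this critical delay is itself an admissible `τ`, so larger delays need no analysis.
-/

/-! ### Spectrum of the delay step operator -/

/-- The translation operator of `x'(t) = -a x(t - 1)` over one delay interval, by the method of
steps: the history `φ` on `[0, 1]` is sent to `θ ↦ φ 1 - a ∫₀^θ φ`. -/
noncomputable def delayStep (a : ℝ) : C(unitInterval, ℂ) →L[ℂ] C(unitInterval, ℂ) :=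
  LinearMap.mkContinuous
    { toFun := fun φ =>
        { toFun := fun θ => φ 1 - a * ∫ s in (0 : ℝ)..θ, Set.IccExtend zero_le_one φ s
          continuous_toFun := by
            have h : Continuous (Set.IccExtend (zero_le_one (α := ℝ)) φ) :=
              φ.continuous.Icc_extend'
            exact continuous_const.sub (continuous_const.mul
              ((intervalIntegral.continuous_primitive
                (fun _ _ => h.intervalIntegrable _ _) 0).comp continuous_subtype_val)) }
      map_add' := fun φ ψ => by
        ext θ
        have h (χ : C(unitInterval, ℂ)) : Continuous (Set.IccExtend (zero_le_one (α := ℝ)) χ) :=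
          χ.continuous.Icc_extend'
        have := intervalIntegral.integral_add ((h φ).intervalIntegrable 0 θ)
          ((h ψ).intervalIntegrable 0 θ) (μ := MeasureTheory.volume)
        simp only [Set.IccExtend, Function.comp_apply, ContinuousMap.coe_mk,
          ContinuousMap.add_apply] at this ⊢
        rw [this]
        ring
      map_smul' := fun c φ => by
        ext θ
        simp only [Set.IccExtend, Function.comp_apply, ContinuousMap.coe_mk,
          ContinuousMap.smul_apply, RingHom.id_apply, smul_eq_mul,
          intervalIntegral.integral_const_mul]
        ring } (1 + |a|) (by
    intro φ
    refine (ContinuousMap.norm_le _ (by positivity)).2 fun θ => ?_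
    have h1 : ‖∫ s in (0 : ℝ)..θ, Set.IccExtend zero_le_one φ s‖ ≤ ‖φ‖ * |(θ : ℝ) - 0| :=
      intervalIntegral.norm_integral_le_of_norm_le_const fun s _ => φ.norm_coe_le_norm _
    have h2 : |(θ : ℝ) - 0| ≤ 1 := by
      rw [sub_zero, abs_of_nonneg θ.2.1]; exact θ.2.2
    have h3 : ‖∫ s in (0 : ℝ)..θ, Set.IccExtend zero_le_one φ s‖ ≤ ‖φ‖ :=
      h1.trans (mul_le_of_le_one_right (norm_nonneg _) h2)
    calc ‖φ 1 - a * ∫ s in (0 : ℝ)..θ, Set.IccExtend zero_le_one φ s‖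
        ≤ ‖φ 1‖ + ‖(a : ℂ) * ∫ s in (0 : ℝ)..θ, Set.IccExtend zero_le_one φ s‖ := norm_sub_le _ _
      _ ≤ ‖φ‖ + |a| * ‖φ‖ := by
          rw [norm_mul, Complex.norm_real, Real.norm_eq_abs]
          exact add_le_add (φ.norm_coe_le_norm _) (by gcongr)
      _ = (1 + |a|) * ‖φ‖ := by ring)

theorem delayStep_apply (a : ℝ) (φ : C(unitInterval, ℂ)) (θ : unitInterval) :
    delayStep a φ θ = φ 1 - a * ∫ s in (0 : ℝ)..θ, Set.IccExtend zero_le_one φ s :=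
  rfl

/-- The eigenvalue equation forces `φ' = -(a / μ) φ` and `μ φ(0) = φ(1)`, so a nonzero exponential
solution would need `μ = exp (-(a / μ))`. -/
theorem delayStep_eigenvector_eq_zero {a : ℝ} {μ : ℂ} (hμ : μ ≠ 0)
    (hchar : μ ≠ Complex.exp (-(a / μ))) {φ : C(unitInterval, ℂ)}
    (h : μ • φ = delayStep a φ) : φ = 0 := by
  set e : ℝ → ℂ := Set.IccExtend zero_le_one φ with he
  have hcont : Continuous e := φ.continuous.Icc_extend'
  set P : ℝ → ℂ := fun t => φ 1 - a * ∫ s in (0 : ℝ)..t, e s with hP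
  have hφP (θ : unitInterval) : μ * φ θ = P θ := by
    have := DFunLike.congr_fun h θ
    rwa [delayStep_apply] at this
  have hPd (t : ℝ) : HasDerivAt P (-(a * e t)) t := by
    have := ((intervalIntegral.integral_hasDerivAt_right (hcont.intervalIntegrable 0 t)
      (hcont.stronglyMeasurableAtFilter _ _) hcont.continuousAt).const_mul (a : ℂ)).const_sub (φ 1)
    exact this
  have hE (t : ℝ) : HasDerivAt (fun t : ℝ => Complex.exp (a / μ * t))
      (Complex.exp (a / μ * t) * (a / μ)) t := by
    have h0 : HasDerivAt (fun t : ℝ => (a : ℂ) / μ * t) (a / μ) t := by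
      simpa using (Complex.ofRealCLM.hasDerivAt (x := t)).const_mul ((a : ℂ) / μ)
    exact h0.cexp
  have hconst : ∀ t ∈ Set.Icc (0 : ℝ) 1, P t * Complex.exp (a / μ * t) = φ 1 := by
    intro t ht
    have := constant_of_has_deriv_right_zero (a := (0 : ℝ)) (b := 1)
      (f := fun t => P t * Complex.exp (a / μ * t))
      (fun t _ => ((hPd t).mul (hE t)).continuousAt.continuousWithinAt)
      (fun t ht => by
        have hd := (hPd t).mul (hE t)
        have hz : -(a * e t) * Complex.exp (a / μ * t)
            + P t * (Complex.exp (a / μ * t) * (a / μ)) = 0 := by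
          have := hφP ⟨t, ht.1, ht.2.le⟩
          have het : e t = φ ⟨t, ht.1, ht.2.le⟩ := Set.IccExtend_of_mem _ _ ⟨ht.1, ht.2.le⟩
          simp only at this
          rw [← this, het]
          field_simp
          ring
        rw [hz] at hd
        exact hd.hasDerivWithinAt) t ht
    simpa [hP] using this
  have h1 : φ 1 = 0 := by
    have hc := hconst 1 ⟨zero_le_one, le_rfl⟩
    have hp := hφP 1
    rw [Set.Icc.coe_one] at hp
    rw [← hp, Complex.ofReal_one, mul_one] at hc
    by_contra hne
    apply hchar
    rw [Complex.exp_neg]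
    apply eq_inv_of_mul_eq_one_left
    apply mul_right_cancel₀ hne
    linear_combination hc
  ext θ
  have hc := hconst θ θ.2
  rw [h1, ← hφP θ] at hc
  simpa [hμ, Complex.exp_ne_zero] using hc

/-- Variation of constants: `φ = (g + Q) / μ`, where `Q' = -b (g + Q)` and `Q 0 = φ 1`. -/
theorem exists_smul_sub_delayStep_eq {a : ℝ} {μ : ℂ} (hμ : μ ≠ 0)
    (hchar : μ ≠ Complex.exp (-(a / μ))) (g : C(unitInterval, ℂ)) :
    ∃ φ, μ • φ - delayStep a φ = g := by
  set e : ℝ → ℂ := Set.IccExtend zero_le_one g with he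
  have hcont : Continuous e := g.continuous.Icc_extend'
  set b : ℂ := a / μ with hb
  have hbμ : b * μ = a := div_mul_cancel₀ _ hμ
  have hce : Continuous fun s : ℝ => Complex.exp (b * s) * e s := by fun_prop
  set J : ℝ → ℂ := fun t => ∫ s in (0 : ℝ)..t, Complex.exp (b * s) * e s with hJ
  have hJd (t : ℝ) : HasDerivAt J (Complex.exp (b * t) * e t) t :=
    intervalIntegral.integral_hasDerivAt_right (hce.intervalIntegrable 0 t)
      (hce.stronglyMeasurableAtFilter _ _) hce.continuousAt
  have hE (t : ℝ) : HasDerivAt (fun t : ℝ => Complex.exp (-b * t))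
      (Complex.exp (-b * t) * (-b)) t := by
    have h0 : HasDerivAt (fun t : ℝ => -b * t) (-b) t := by
      simpa using (Complex.ofRealCLM.hasDerivAt (x := t)).const_mul (-b)
    exact h0.cexp
  have hne : μ - Complex.exp (-b) ≠ 0 := sub_ne_zero.2 hchar
  -- `c` is the unknown value `φ 1`; consistency at `θ = 1` is linear in it, with coefficient `μ -
  -- exp (-b)`.
  obtain ⟨c, hc⟩ : ∃ c : ℂ, μ * c = g 1 + Complex.exp (-b) * (c - b * J 1) :=
    ⟨(g 1 - Complex.exp (-b) * (b * J 1)) / (μ - Complex.exp (-b)), by field_simp; ring⟩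
  set Q : ℝ → ℂ := fun t => Complex.exp (-b * t) * (c - b * J t) with hQ
  have hQd (t : ℝ) : HasDerivAt Q (-(b * (e t + Q t))) t := by
    refine ((hE t).mul (((hJd t).const_mul b).const_sub c)).congr_deriv ?_
    have : Complex.exp (-b * t) * Complex.exp (b * t) = 1 := by
      rw [← Complex.exp_add]; simp
    simp only [hQ]
    linear_combination (-(b * e t)) * this
  have hQc : Continuous Q := continuous_iff_continuousAt.2 fun t => (hQd t).continuousAt
  let φ : C(unitInterval, ℂ) := ⟨fun θ => (g θ + Q θ) / μ, by fun_prop⟩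
  have hφ (θ : unitInterval) : φ θ = (g θ + Q θ) / μ := rfl
  have hφ1 : φ 1 = c := by
    rw [hφ, div_eq_iff hμ, Set.Icc.coe_one]
    simp only [hQ, Complex.ofReal_one, mul_one]
    linear_combination -hc
  have hQ0 : Q 0 = c := by simp [hQ, hJ]
  refine ⟨φ, ?_⟩
  ext θ
  have hint : ∫ s in (0 : ℝ)..θ, -(b * (e s + Q s)) = Q θ - Q 0 :=
    intervalIntegral.integral_eq_sub_of_hasDerivAt (fun t _ => hQd t)
      ((by fun_prop : Continuous fun s => -(b * (e s + Q s))).intervalIntegrable _ _)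
  have hint' : ∫ s in (0 : ℝ)..θ, -(b * (e s + Q s))
      = -(a * ∫ s in (0 : ℝ)..θ, Set.IccExtend zero_le_one φ s) := by
    rw [← intervalIntegral.integral_const_mul, ← intervalIntegral.integral_neg]
    refine intervalIntegral.integral_congr fun s hs => ?_
    rw [Set.uIcc_of_le θ.2.1] at hs
    have hs' : s ∈ Set.Icc (0 : ℝ) 1 := ⟨hs.1, hs.2.trans θ.2.2⟩
    simp only [he]
    rw [Set.IccExtend_of_mem _ _ hs', Set.IccExtend_of_mem _ _ hs', hφ, ← hbμ]
    field_simp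
  rw [ContinuousMap.sub_apply, ContinuousMap.smul_apply, delayStep_apply, hφ1, smul_eq_mul, hφ,
    mul_div_cancel₀ _ hμ]
  rw [hint', hQ0] at hint
  linear_combination -hint

theorem mem_resolventSet_delayStep {a : ℝ} {μ : ℂ} (hμ : μ ≠ 0)
    (hchar : μ ≠ Complex.exp (-(a / μ))) : μ ∈ resolventSet ℂ (delayStep a) := by
  have happ (φ : C(unitInterval, ℂ)) :
      (algebraMap ℂ (C(unitInterval, ℂ) →L[ℂ] C(unitInterval, ℂ)) μ - delayStep a) φ
        = μ • φ - delayStep a φ := rfl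
  rw [spectrum.mem_resolventSet_iff, ContinuousLinearMap.isUnit_iff_bijective]
  constructor
  · rw [injective_iff_map_eq_zero]
    intro φ hφ
    rw [happ, sub_eq_zero] at hφ
    exact delayStep_eigenvector_eq_zero hμ hchar hφ
  · intro g
    obtain ⟨φ, hφ⟩ := exists_smul_sub_delayStep_eq hμ hchar g
    exact ⟨φ, (happ φ).trans hφ⟩

/-- Put `w = 1 / μ`, so `w = exp (a w)`. Taking norms, `1 ≤ ‖μ‖` gives `Re w ≤ 0`; but `|a Im w| < π
/ 2`, so `Re w`, a positive multiple of `cos (a Im w)`, is positive. -/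
theorem delay_characteristic_ne {a : ℝ} (ha : 0 < a) (ha' : a < Real.pi / 2) {μ : ℂ}
    (hμ : 1 ≤ ‖μ‖) : μ ≠ Complex.exp (-(a / μ)) := by
  intro h
  set w : ℂ := μ⁻¹ with hw
  have hμw : (a : ℂ) / μ = a * w := div_eq_mul_inv _ _
  rw [hμw] at h
  have hre : w.re ≤ 0 := by
    rw [h, Complex.norm_exp, Real.one_le_exp_iff] at hμ
    simp only [Complex.neg_re, Complex.re_ofReal_mul] at hμ
    nlinarith
  have hwle : ‖w‖ ≤ 1 := by rw [hw, norm_inv]; exact inv_le_one_of_one_le₀ hμ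
  have him : |w.im| ≤ 1 := (Complex.abs_im_le_norm w).trans hwle
  have hexp : w = Complex.exp (a * w) := by
    rw [Complex.exp_neg] at h
    exact (congrArg (·⁻¹) h).trans (inv_inv _)
  have : 0 < w.re := by
    rw [hexp, Complex.exp_re, Complex.re_ofReal_mul, Complex.im_ofReal_mul]
    have := abs_le.1 him
    exact mul_pos (Real.exp_pos _) (Real.cos_pos_of_mem_Ioo ⟨by nlinarith, by nlinarith⟩)
  linarith

theorem norm_lt_one_of_mem_spectrum_delayStep {a : ℝ} (ha : 0 < a) (ha' : a < Real.pi / 2)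
    {μ : ℂ} (hμ : μ ∈ spectrum ℂ (delayStep a)) : ‖μ‖ < 1 := by
  by_contra! hle
  have h0 : μ ≠ 0 := norm_pos_iff.1 (by linarith)
  exact hμ (mem_resolventSet_delayStep h0 (delay_characteristic_ne ha ha' hle))

theorem tendsto_norm_pow_of_spectrum_norm_lt_one {A : Type*} [NormedRing A] [NormedAlgebra ℂ A]
    [CompleteSpace A] [Nontrivial A] {x : A} (hx : ∀ μ ∈ spectrum ℂ x, ‖μ‖ < 1) :
    Filter.Tendsto (fun n : ℕ => ‖x ^ n‖) Filter.atTop (nhds 0) := by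
  have h : spectralRadius ℂ x < 1 :=
    spectrum.spectralRadius_lt_of_forall_lt (r := 1) x fun μ hμ => by exact_mod_cast hx μ hμ
  obtain ⟨r, hr, hr1⟩ := ENNReal.lt_iff_exists_nnreal_btwn.1 h
  have hr1' : (r : ℝ) < 1 := by exact_mod_cast hr1
  have hev := (spectrum.pow_nnnorm_pow_one_div_tendsto_nhds_spectralRadius x).eventually
    (gt_mem_nhds hr)
  refine squeeze_zero' (Filter.Eventually.of_forall fun _ => norm_nonneg _) ?_
    (tendsto_pow_atTop_nhds_zero_of_lt_one r.2 hr1')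
  filter_upwards [hev, Filter.eventually_gt_atTop 0] with n hn hn0
  have hn' : (0 : ℝ) < n := by exact_mod_cast hn0
  have h2 := ENNReal.rpow_le_rpow hn.le hn'.le
  rw [← ENNReal.rpow_mul, one_div_mul_cancel hn'.ne', ENNReal.rpow_one, ENNReal.rpow_natCast] at h2
  exact_mod_cast h2

theorem tendsto_norm_delayStep_pow {a : ℝ} (ha : 0 < a) (ha' : a < Real.pi / 2) :
    Filter.Tendsto (fun n : ℕ => ‖delayStep a ^ n‖) Filter.atTop (nhds 0) := by
  have h := tendsto_norm_pow_of_spectrum_norm_lt_one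
    (A := C(unitInterval, ℂ) →L[ℂ] C(unitInterval, ℂ)) (x := delayStep a)
    fun _ hμ => norm_lt_one_of_mem_spectrum_delayStep ha ha' hμ
  exact h

/-! ### Scalar delay equation via iterates of the step operator -/

/-- The restriction of `f` to the `n`-th delay interval `[(n - 1) τ, n τ]`, rescaled to `[0, 1]`. -/
noncomputable def delaySegment {τ : ℝ} (hτ : 0 < τ) {f : ℝ → ℝ}
    (hf : ContinuousOn f (Set.Ici (-τ))) (n : ℕ) : C(unitInterval, ℂ) where
  toFun θ := (f (τ * (n - 1 + θ)) : ℂ)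
  continuous_toFun := by
    refine Complex.continuous_ofReal.comp (hf.comp_continuous (by fun_prop) fun θ => ?_)
    have h0 := θ.2.1
    have hn : (0 : ℝ) ≤ n := n.cast_nonneg
    have : 0 ≤ τ * (n + θ) := by positivity
    rw [Set.mem_Ici]
    linarith

theorem delaySegment_apply {τ : ℝ} (hτ : 0 < τ) {f : ℝ → ℝ}
    (hf : ContinuousOn f (Set.Ici (-τ))) (n : ℕ) (θ : unitInterval) :
    delaySegment hτ hf n θ = (f (τ * (n - 1 + θ)) : ℂ) :=
  rfl

theorem delaySegment_succ {τ l : ℝ} (hτ : 0 < τ) {f : ℝ → ℝ}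
    (hf : ContinuousOn f (Set.Ici (-τ)))
    (hd : ∀ t, 0 < t → HasDerivAt f (-l * f (t - τ)) t) (n : ℕ) :
    delaySegment hτ hf (n + 1) = delayStep (l * τ) (delaySegment hτ hf n) := by
  ext θ
  have hn : (0 : ℝ) ≤ n := n.cast_nonneg
  set e : ℝ → ℂ := Set.IccExtend zero_le_one (delaySegment hτ hf n) with he
  have hcont : Continuous e := (delaySegment hτ hf n).continuous.Icc_extend'
  have hint : ∫ s in (0 : ℝ)..θ, -((l * τ : ℝ) * e s)
      = (f (τ * (n + θ)) : ℂ) - (f (τ * (n + (0 : ℝ))) : ℂ) := by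
    -- The derivative is needed only in the open interval: for `n = 0` the left endpoint is `t = 0`,
    -- where the equation is not assumed.
    refine intervalIntegral.integral_eq_sub_of_hasDerivAt_of_le
      (f := fun s : ℝ => (f (τ * (n + s)) : ℂ)) θ.2.1 ?_ ?_
      ((by fun_prop : Continuous fun s => -((l * τ : ℝ) * e s)).intervalIntegrable _ _)
    · refine Complex.continuous_ofReal.comp_continuousOn (hf.comp (by fun_prop) fun s hs => ?_)
      have h0 := hs.1
      have : 0 ≤ τ * (n + s) := by positivity
      rw [Set.mem_Ici]
      linarith
    · intro s hs
      have h0 := hs.1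
      have hpos : 0 < τ * (n + s) := by positivity
      have hes : e s = (f (τ * (n + s) - τ) : ℂ) := by
        rw [he, Set.IccExtend_of_mem _ _ ⟨h0.le, hs.2.le.trans θ.2.2⟩, delaySegment_apply]
        congr 2
        ring
      have hlin : HasDerivAt (fun s : ℝ => τ * (n + s)) τ s := by
        simpa using ((hasDerivAt_id s).const_add (n : ℝ)).const_mul τ
      refine ((hd _ hpos).comp s hlin).ofReal_comp.congr_deriv ?_
      rw [hes]
      push_cast
      ring
  rw [intervalIntegral.integral_neg, intervalIntegral.integral_const_mul] at hint
  rw [delayStep_apply, delaySegment_apply, delaySegment_apply]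
  simp only [Set.Icc.coe_one, Nat.cast_add, Nat.cast_one, add_sub_cancel_right, sub_add_cancel]
  rw [add_zero] at hint
  linear_combination -hint

theorem delaySegment_eq_pow {τ l : ℝ} (hτ : 0 < τ) {f : ℝ → ℝ}
    (hf : ContinuousOn f (Set.Ici (-τ)))
    (hd : ∀ t, 0 < t → HasDerivAt f (-l * f (t - τ)) t) (n : ℕ) :
    delaySegment hτ hf n = (delayStep (l * τ) ^ n) (delaySegment hτ hf 0) := by
  induction n with
  | zero => rfl
  | succ n ih => rw [delaySegment_succ hτ hf hd, ih, pow_succ']; rfl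

theorem abs_le_norm_delayStep_pow_mul {τ l : ℝ} (hτ : 0 < τ) {f : ℝ → ℝ}
    (hf : ContinuousOn f (Set.Ici (-τ)))
    (hd : ∀ t, 0 < t → HasDerivAt f (-l * f (t - τ)) t) {t : ℝ} (ht : 0 ≤ t) :
    |f t| ≤ ‖delayStep (l * τ) ^ (⌊t / τ⌋₊ + 1)‖ * ‖delaySegment hτ hf 0‖ := by
  have h1 : (⌊t / τ⌋₊ : ℝ) ≤ t / τ := Nat.floor_le (by positivity)
  have h2 : t / τ < ⌊t / τ⌋₊ + 1 := Nat.lt_floor_add_one _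
  -- The shift by one is there because segment `0` is the history.
  have h3 : delaySegment hτ hf (⌊t / τ⌋₊ + 1)
      ⟨t / τ - ⌊t / τ⌋₊, by linarith, by linarith⟩ = (f t : ℂ) := by
    rw [delaySegment_apply]
    congr 2
    push_cast
    field_simp
    ring
  rw [← Real.norm_eq_abs, ← Complex.norm_real, ← h3]
  refine (ContinuousMap.norm_coe_le_norm _ _).trans ?_
  rw [delaySegment_eq_pow hτ hf hd]
  exact ContinuousLinearMap.le_opNorm _ _

theorem eq_mul_exp_of_hasDerivAt {l : ℝ} {f : ℝ → ℝ} (hf : ContinuousOn f (Set.Ici 0))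
    (hd : ∀ t, 0 < t → HasDerivAt f (-l * f t) t) {t : ℝ} (ht : 0 ≤ t) :
    f t = f 0 * Real.exp (-(l * t)) := by
  have hE (s : ℝ) : HasDerivAt (fun s => Real.exp (l * s)) (Real.exp (l * s) * l) s := by
    simpa using ((hasDerivAt_id s).const_mul l).exp
  have hint : ∫ _ in (0 : ℝ)..t, (0 : ℝ) = f t * Real.exp (l * t) - f 0 * Real.exp (l * 0) := by
    refine intervalIntegral.integral_eq_sub_of_hasDerivAt_of_le
      (f := fun s => f s * Real.exp (l * s)) ht
      ((hf.mono fun s hs => hs.1).mul (by fun_prop)) (fun s hs => ?_)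
      (continuous_const.intervalIntegrable _ _)
    refine ((hd s hs.1).mul (hE s)).congr_deriv ?_
    ring
  rw [intervalIntegral.integral_zero, mul_zero, Real.exp_zero, mul_one] at hint
  rw [Real.exp_neg, ← div_eq_mul_inv, eq_div_iff (Real.exp_pos _).ne']
  linarith

/-- The scalar equation `f'(t) = -l f(t - τ)` is asymptotically stable when `0 < l` and
`l τ < π / 2`. -/
theorem exists_bound_and_tendsto_of_scalar_delay {τ l : ℝ} (hτ : 0 ≤ τ) (hl : 0 < l)
    (hlτ : l * τ < Real.pi / 2) :
    ∃ C : ℝ, 0 ≤ C ∧ ∀ f : ℝ → ℝ, ContinuousOn f (Set.Ici (-τ)) →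
      (∀ t, 0 < t → HasDerivAt f (-l * f (t - τ)) t) →
      (∀ M, (∀ s ∈ Set.Icc (-τ) 0, |f s| ≤ M) → ∀ t, 0 ≤ t → |f t| ≤ C * M) ∧
        Filter.Tendsto f Filter.atTop (nhds 0) := by
  rcases hτ.eq_or_lt with rfl | hτ
  · refine ⟨1, zero_le_one, fun f hf hd => ?_⟩
    simp only [neg_zero, sub_zero] at hf hd ⊢
    have hsol := fun t (ht : 0 ≤ t) => eq_mul_exp_of_hasDerivAt hf hd ht
    constructor
    · intro M hM t ht
      rw [hsol t ht, abs_mul, Real.abs_exp, one_mul]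
      refine (mul_le_of_le_one_right (abs_nonneg _) ?_).trans (hM 0 (by simp))
      rw [Real.exp_le_one_iff]
      nlinarith
    · have h1 : Filter.Tendsto (fun t => f 0 * Real.exp (-(l * t))) Filter.atTop (nhds (f 0 * 0)) :=
        (Real.tendsto_exp_neg_atTop_nhds_zero.comp
          (Filter.tendsto_id.const_mul_atTop hl)).const_mul _
      rw [mul_zero] at h1
      refine h1.congr' ?_
      filter_upwards [Filter.eventually_ge_atTop 0] with t ht using (hsol t ht).symm
  · have hlim := tendsto_norm_delayStep_pow (mul_pos hl hτ) hlτ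
    obtain ⟨C, hC⟩ := hlim.bddAbove_range
    have hC' (n : ℕ) : ‖delayStep (l * τ) ^ n‖ ≤ C := hC ⟨n, rfl⟩
    have hC0 : 0 ≤ C := (norm_nonneg (delayStep (l * τ) ^ 0)).trans (hC' 0)
    refine ⟨C, hC0, fun f hf hd => ⟨fun M hM t ht => ?_, ?_⟩⟩
    · have hM0 : 0 ≤ M := (abs_nonneg _).trans (hM 0 ⟨by linarith, le_rfl⟩)
      refine (abs_le_norm_delayStep_pow_mul hτ hf hd ht).trans
        (mul_le_mul (hC' _) ?_ (norm_nonneg _) hC0)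
      refine (ContinuousMap.norm_le _ hM0).2 fun θ => ?_
      rw [delaySegment_apply, Complex.norm_real, Real.norm_eq_abs]
      have h0 := θ.2.1
      have h1 := θ.2.2
      apply hM
      constructor
      · push_cast
        nlinarith
      · push_cast
        nlinarith
    · have hfloor : Filter.Tendsto (fun t : ℝ => ⌊t / τ⌋₊ + 1) Filter.atTop Filter.atTop :=
        (Filter.tendsto_add_atTop_nat 1).comp
          (tendsto_nat_floor_atTop.comp (Filter.tendsto_id.atTop_div_const hτ))
      have h1 := (hlim.comp hfloor).mul_const ‖delaySegment hτ hf 0‖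
      rw [zero_mul] at h1
      refine squeeze_zero_norm' ?_ h1
      filter_upwards [Filter.eventually_ge_atTop 0] with t ht
      exact abs_le_norm_delayStep_pow_mul hτ hf hd ht

/-! ### Diagonalisation of symmetric delay systems -/

theorem Matrix.IsHermitian.eq_sum_dotProduct_smul_eigenvectorBasis {ι : Type*} [Fintype ι]
    [DecidableEq ι] {A : Matrix ι ι ℝ} (hA : A.IsHermitian) (x : ι → ℝ) :
    x = ∑ i, (⇑(hA.eigenvectorBasis i) ⬝ᵥ x) • (⇑(hA.eigenvectorBasis i) : ι → ℝ) := by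
  have h := hA.eigenvectorBasis.sum_repr' (WithLp.toLp 2 x)
  have h' := congrArg WithLp.ofLp h
  rw [WithLp.ofLp_sum] at h'
  simp only [WithLp.ofLp_smul, EuclideanSpace.inner_eq_star_dotProduct, star_trivial] at h'
  rw [← h']
  refine Finset.sum_congr rfl fun i _ => ?_
  rw [h', dotProduct_comm]

theorem Matrix.IsHermitian.eigenvectorBasis_dotProduct_mulVec {ι : Type*} [Fintype ι]
    [DecidableEq ι] {A : Matrix ι ι ℝ} (hA : A.IsHermitian) (i : ι) (x : ι → ℝ) :
    ⇑(hA.eigenvectorBasis i) ⬝ᵥ A.mulVec x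
      = hA.eigenvalues i * (⇑(hA.eigenvectorBasis i) ⬝ᵥ x) := by
  have hT : A.transpose = A := by
    rw [← Matrix.conjTranspose_eq_transpose_of_trivial]; exact hA
  rw [Matrix.dotProduct_mulVec, ← Matrix.mulVec_transpose, hT, hA.mulVec_eigenvectorBasis,
    smul_dotProduct, smul_eq_mul]

/-- A symmetric delay system `x'(t) = -A x(t - τ)` with positive eigenvalues `λ` satisfying
`λ τ < π / 2` is asymptotically stable. -/
theorem Matrix.IsHermitian.isAsymptoticallyStableDelay_neg {ι : Type*} [Fintype ι]
    [DecidableEq ι] {A : Matrix ι ι ℝ} (hA : A.IsHermitian) {τ : ℝ} (hτ : 0 ≤ τ)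
    (hpos : ∀ i, 0 < hA.eigenvalues i) (hlt : ∀ i, hA.eigenvalues i * τ < Real.pi / 2) :
    IsAsymptoticallyStableDelay (-A) τ := by
  choose C hC0 hC using fun i => exists_bound_and_tendsto_of_scalar_delay hτ (hpos i) (hlt i)
  set v : ι → ι → ℝ := fun i => ⇑(hA.eigenvectorBasis i) with hv
  -- The ℓ¹ norm bounds the coordinate functional `v i ⬝ᵥ ·` in the max norm, and also each entry of
  -- `v i`; hence `K i` appears twice in `B` below.
  set K : ι → ℝ := fun i => ∑ j, |v i j| with hK
  have hK0 (i : ι) : 0 ≤ K i := Finset.sum_nonneg fun _ _ => abs_nonneg _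
  have hcoord (x : ℝ → ι → ℝ) (hx : IsDelaySolution (-A) τ x) (i : ι) :=
    hC i (fun t => v i ⬝ᵥ x t)
      (by
        have h := hx.continuousOn
        rw [continuousOn_pi] at h
        exact continuousOn_finsetSum _ fun j _ => continuousOn_const.mul (h j))
      (fun t ht => by
        have h := hasDerivAt_pi.1 (hx.hasDerivAt t ht)
        have h2 : HasDerivAt (fun t => v i ⬝ᵥ x t) (v i ⬝ᵥ (-A).mulVec (x (t - τ))) t :=
          HasDerivAt.fun_sum fun j _ => (h j).const_mul (v i j)
        rwa [Matrix.neg_mulVec, dotProduct_neg, hA.eigenvectorBasis_dotProduct_mulVec,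
          ← neg_mul] at h2)
  constructor
  · intro ε hε
    set B : ℝ := ∑ i, C i * K i * K i with hB
    have hB0 : 0 ≤ B := Finset.sum_nonneg fun i _ =>
      mul_nonneg (mul_nonneg (hC0 i) (hK0 i)) (hK0 i)
    have hδ : 0 < ε / (B + 1) := by positivity
    refine ⟨ε / (B + 1), hδ, fun x hx hhist t ht => ?_⟩
    have hy (i : ι) : |v i ⬝ᵥ x t| ≤ C i * (K i * (ε / (B + 1))) := by
      refine (hcoord x hx i).1 (K i * (ε / (B + 1))) (fun s hs => ?_) t ht
      rw [hK, Finset.sum_mul]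
      refine (Finset.abs_sum_le_sum_abs _ _).trans (Finset.sum_le_sum fun j _ => ?_)
      rw [abs_mul]
      gcongr
      exact (norm_le_pi_norm (x s) j).trans (hhist s hs).le
    have hle : ‖x t‖ ≤ B * (ε / (B + 1)) := by
      refine (pi_norm_le_iff_of_nonneg (by positivity)).2 fun j => ?_
      rw [hA.eq_sum_dotProduct_smul_eigenvectorBasis (x t), Finset.sum_apply, hB, Finset.sum_mul]
      refine (norm_sum_le _ _).trans (Finset.sum_le_sum fun i _ => ?_)
      rw [Pi.smul_apply, norm_smul, Real.norm_eq_abs, Real.norm_eq_abs]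
      have hvK : |v i j| ≤ K i :=
        Finset.single_le_sum (f := fun j => |v i j|) (fun _ _ => abs_nonneg _) (Finset.mem_univ j)
      calc |v i ⬝ᵥ x t| * |v i j| ≤ (C i * (K i * (ε / (B + 1)))) * K i :=
            mul_le_mul (hy i) hvK (abs_nonneg _) ((abs_nonneg _).trans (hy i))
        _ = C i * K i * K i * (ε / (B + 1)) := by ring
    refine hle.trans_lt ?_
    rw [mul_div_assoc', div_lt_iff₀ (by positivity)]
    nlinarith
  · intro x hx
    have h : Filter.Tendsto (fun t => ∑ i, (v i ⬝ᵥ x t) • v i) Filter.atTop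
        (nhds (∑ i, (0 : ℝ) • v i)) :=
      tendsto_finsetSum _ fun i _ => (hcoord x hx i).2.smul_const (v i)
    simp only [zero_smul, Finset.sum_const_zero] at h
    exact h.congr fun t => (hA.eq_sum_dotProduct_smul_eigenvectorBasis (x t)).symm

/-! ### Failure of attraction at the critical delay -/

/-- At the critical delay `π / (2 l)` the system has the undamped solution `cos (l t) • v`. -/
theorem isDelaySolution_cos_smul {ι : Type*} [Fintype ι] {A : Matrix ι ι ℝ} {l : ℝ} (hl : l ≠ 0)
    {v : ι → ℝ} (hv : A.mulVec v = l • v) :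
    IsDelaySolution (-A) (Real.pi / (2 * l)) fun t => Real.cos (l * t) • v := by
  refine ⟨by fun_prop, fun t _ => ?_⟩
  have h0 : HasDerivAt (fun t => Real.cos (l * t)) (-Real.sin (l * t) * l) t := by
    simpa using ((hasDerivAt_id t).const_mul l).cos
  refine (h0.smul_const v).congr_deriv ?_
  have harg : l * (t - Real.pi / (2 * l)) = l * t - Real.pi / 2 := by field_simp
  rw [Matrix.neg_mulVec, Matrix.mulVec_smul, hv, harg, Real.cos_sub_pi_div_two, smul_smul, neg_mul,
    neg_smul]

theorem not_isAsymptoticallyStableDelay_neg_of_eigenvector {ι : Type*} [Fintype ι]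
    {A : Matrix ι ι ℝ} {l : ℝ} (hl : 0 < l) {v : ι → ℝ} (hv0 : v ≠ 0) (hv : A.mulVec v = l • v) :
    ¬ IsAsymptoticallyStableDelay (-A) (Real.pi / (2 * l)) := by
  intro h
  -- Sampling at whole periods `2 π n / l` gives the constant sequence `v ≠ 0`.
  have hlim := (h.attractive _ (isDelaySolution_cos_smul hl.ne' hv)).comp
    ((tendsto_natCast_atTop_atTop (R := ℝ)).atTop_mul_const
      (show 0 < 2 * Real.pi / l by positivity))
  have hconst : ((fun t => Real.cos (l * t) • v) ∘ fun n : ℕ => (n : ℝ) * (2 * Real.pi / l))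
      = fun _ => v := by
    funext n
    have : l * ((n : ℝ) * (2 * Real.pi / l)) = n * (2 * Real.pi) := by field_simp
    simp only [Function.comp_apply]
    rw [this, Real.cos_nat_mul_two_pi, one_smul]
  rw [hconst] at hlim
  exact hv0 (tendsto_nhds_unique tendsto_const_nhds hlim)

/-! ### Positivity of the grounded Laplacian and the main theorem -/

theorem groundedLaplacian_dotProduct_mulVec_pos {V : Type*} [Fintype V] [DecidableEq V]
    (G : SimpleGraph V) [DecidableRel G.Adj] (hG : G.Connected) (R : Finset V) (hR : R.Nonempty)
    {x : Follower R → ℝ} (hx : x ≠ 0) : 0 < x ⬝ᵥ (groundedLaplacian G R).mulVec x := by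
  -- Extension by zero turns the grounded quadratic form into that of the full Laplacian.
  set z : V → ℝ := fun u => if h : u ∉ R then x ⟨u, h⟩ else 0 with hz
  have hzmem (u : V) (hu : u ∈ R) : z u = 0 := by simp [hz, hu]
  have hzval (u : Follower R) : z u = x u := by simp only [hz]; rw [dif_pos u.2]
  have hsum (g : V → ℝ) (hg : ∀ u ∈ R, g u = 0) : ∑ u, g u = ∑ u : Follower R, g u := by
    rw [← Finset.sum_subtype Rᶜ (fun _ => Finset.mem_compl) g]
    refine (Finset.sum_subset (Finset.subset_univ _) fun u _ hu => hg u ?_).symm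
    simpa using hu
  have hquad : x ⬝ᵥ (groundedLaplacian G R).mulVec x
      = Matrix.toLinearMap₂' ℝ (G.lapMatrix ℝ) z z := by
    rw [Matrix.toLinearMap₂'_apply']
    simp only [dotProduct, Matrix.mulVec]
    rw [hsum _ fun u hu => by rw [hzmem u hu, zero_mul]]
    refine Finset.sum_congr rfl fun u _ => ?_
    rw [hzval, hsum _ fun w hw => by rw [hzmem w hw, mul_zero]]
    congr 1
    refine Finset.sum_congr rfl fun w _ => ?_
    rw [hzval]
    rfl
  rw [hquad]
  have hnonneg : 0 ≤ Matrix.toLinearMap₂' ℝ (G.lapMatrix ℝ) z z := by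
    rw [SimpleGraph.lapMatrix_toLinearMap₂']
    positivity
  refine hnonneg.lt_of_ne fun h0 => hx ?_
  have hall := (SimpleGraph.lapMatrix_toLinearMap₂'_apply'_eq_zero_iff_forall_reachable G z).1
    h0.symm
  obtain ⟨r, hr⟩ := hR
  funext u
  rw [← hzval, hall u r (hG.preconnected u r), hzmem r hr, Pi.zero_apply]

theorem groundedEigenvalues_pos {V : Type*} [Fintype V] [DecidableEq V]
    (G : SimpleGraph V) [DecidableRel G.Adj] (hG : G.Connected) (R : Finset V) (hR : R.Nonempty)
    (i : Follower R) : 0 < groundedEigenvalues G R i := by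
  have hA := groundedLaplacian_isHermitian G R
  have hpd : (groundedLaplacian G R).PosDef :=
    .of_dotProduct_mulVec_pos hA fun x hx => by
      rw [star_trivial]
      exact groundedLaplacian_dotProduct_mulVec_pos G hG R hR hx
  exact hpd.eigenvalues_pos i

theorem mainTheorem5 {V : Type*} [Fintype V] [DecidableEq V] (G : SimpleGraph V)
    [DecidableRel G.Adj] (hG : G.Connected) (R : Finset V) (hR : R.Nonempty)
    [Nonempty (Follower R)] (τmax : ℝ) (hτ : 0 ≤ τmax) :
    ((∀ τ ∈ Set.Icc 0 τmax, IsAsymptoticallyStableDelay (-groundedLaplacian G R) τ) ↔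
      τmax < Finset.univ.inf' Finset.univ_nonempty
        (fun i : Follower R => Real.pi / (2 * groundedEigenvalues G R i))) ∧
    Finset.univ.inf' Finset.univ_nonempty
        (fun i : Follower R => Real.pi / (2 * groundedEigenvalues G R i)) =
      Real.pi / (2 * largestGroundedEigenvalue G R) := by
  have hpos := groundedEigenvalues_pos G hG R hR
  have hA := groundedLaplacian_isHermitian G R
  refine ⟨⟨fun h => ?_, fun h τ hmem => ?_⟩, ?_⟩
  · rw [Finset.lt_inf'_iff]
    intro i _
    by_contra! hle
    have hi := hpos i
    refine not_isAsymptoticallyStableDelay_neg_of_eigenvector hi (fun h0 => ?_)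
      (hA.mulVec_eigenvectorBasis i) (h _ ⟨by positivity, hle⟩)
    refine hA.eigenvectorBasis.orthonormal.ne_zero i ?_
    ext j
    exact congrFun h0 j
  · rw [Finset.lt_inf'_iff] at h
    refine hA.isAsymptoticallyStableDelay_neg hmem.1 hpos fun i => ?_
    have h1 := hmem.2.trans_lt (h i (Finset.mem_univ i))
    have hi := hpos i
    rw [lt_div_iff₀ (by positivity)] at h1
    change groundedEigenvalues G R i * τ < Real.pi / 2
    linarith
  · obtain ⟨m, _, hm⟩ := Finset.exists_mem_eq_sup' (s := Finset.univ) Finset.univ_nonempty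
      (groundedEigenvalues G R)
    have hmax : largestGroundedEigenvalue G R = groundedEigenvalues G R m := hm
    apply le_antisymm
    · rw [hmax]
      exact Finset.inf'_le (fun i => Real.pi / (2 * groundedEigenvalues G R i)) (Finset.mem_univ m)
    · refine Finset.le_inf' _ _ fun i _ => ?_
      have hle : groundedEigenvalues G R i ≤ largestGroundedEigenvalue G R :=
        Finset.le_sup' _ (Finset.mem_univ i)
      have hi := hpos i
      have := Real.pi_pos
      gcongr
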